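/- **Proposition 6.6** (prop:comp.cat.cantor). Let $2^\omega$ be Cantor space, i.e. the set of all infinite binary sequences with the product topology. Any two computably compact presentations of $2^\omega$ are computably homeomorphic. Here the terms have the following meaning. - A *presentation* of a Polish space $X$ is a triple $X^\# = (X, d, (p_n)_{n\in\mathbb{N}})$, where $d$ is a complete metric that induces the topology of $X$ and $\{p_n : n \in \mathbb{N}\}$ is dense in $X$. - $X^\#$ is *computable* if the set $\{(r,j,k,r') : r,r'\in\mathbb{Q},\ j,k\in\mathbb{N},\ r<d(p_j,p_k)<r'\}$ is the range of a computable function on $\mathbb{N}$ (rational numbers being coded by tuples of natural numbers). - $X^\#$ is *computably compact* if it is computable and there is a computable function that assigns to each $j\in\mathbb{N}$ (a code of) a finite set $F\subseteq\mathbb{N}$ such that $X=\bigcup_{k\in F}\{x \in X : d(p_k,x)<2^{-j}\}$. - A *name* of a point $x\in X$ (with respect to $X^\#$) is a function $\rho:\mathbb{N}\to\mathbb{N}$ such that $d(p_{\rho(k)},x)<2^{-k}$ for all $k\in\mathbb{N}$. - A map $h:X\to Y$ is *computable from* $X^\#$ *to* $Y^\#$ if there is a single oracle algorithm (a partial recursive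 functional) that, given any name of any point $x\in X$ as an oracle, computes a name of $h(x)$. - $X^\#$ and $Y^\#$ are *computably homeomorphic* if there is a homeomorphism $h$ of $X$ onto $Y$ such that $h$ is computable from $X^\#$ to $Y^\#$ and $h^{-1}$ is computable from $Y^\#$ to $X^\#$. -/

import Mathlib

/-- A presentation `(X, d, (pₙ))` of a topological space `X`: a complete metric `d` that induces
the given topology of `X`, together with a dense sequence of distinguished points. -/
structure Presentation (X : Type*) [t : TopologicalSpace X] where
  /-- the metric `d`; it need not agree with any standard metric of `X` -/
  metric : MetricSpace X
  compatible : metric.toPseudoMetricSpace.toUniformSpace.toTopologicalSpace = t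
  complete : @CompleteSpace X metric.toPseudoMetricSpace.toUniformSpace
  /-- the distinguished points `pₙ` -/
  pts : ℕ → X
  dense : DenseRange pts

/-- Codes of rational numbers: `(a, b, c)` codes `(a - b) / (c + 1)`. -/
def ratOfCode (q : ℕ × ℕ × ℕ) : ℚ := ((q.1 : ℚ) - (q.2.1 : ℚ)) / ((q.2.2 : ℚ) + 1)

/-- Every rational number has a code. -/
theorem ratOfCode_surjective : Function.Surjective ratOfCode := by
  intro q
  refine ⟨(q.num.toNat, (-q.num).toNat, q.den - 1), ?_⟩
  have h1 : ((q.num.toNat : ℚ) - ((-q.num).toNat : ℚ)) = (q.num : ℚ) := by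
    have h : ((q.num.toNat : ℤ) - ((-q.num).toNat : ℤ)) = q.num := by omega
    exact_mod_cast h
  have h2 : (((q.den - 1 : ℕ) : ℚ) + 1) = (q.den : ℚ) := by
    have := q.den_pos
    have h : (q.den - 1) + 1 = q.den := by omega
    exact_mod_cast h
  simp only [ratOfCode]
  rw [h1, h2, Rat.num_div_den]

namespace Presentation

/-- The distance of the presentation. -/
def d {X : Type*} [TopologicalSpace X] (P : Presentation X) (x y : X) : ℝ :=
  P.metric.toPseudoMetricSpace.toDist.dist x y

/-- The diagram: all `(r, j, k, r')` with `r`, `r'` rational and `r < d(p_j, p_k) < r'`. -/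
def diagram {X : Type*} [TopologicalSpace X] (P : Presentation X) : Set (ℚ × ℕ × ℕ × ℚ) :=
  {q | (q.1 : ℝ) < P.d (P.pts q.2.1) (P.pts q.2.2.1) ∧
    P.d (P.pts q.2.1) (P.pts q.2.2.1) < (q.2.2.2 : ℝ)}

/-- `f` is a name of the presentation: it enumerates the diagram, rationals being coded. -/
def IsName {X : Type*} [TopologicalSpace X] (P : Presentation X)
    (f : ℕ → (ℕ × ℕ × ℕ) × ℕ × ℕ × (ℕ × ℕ × ℕ)) : Prop :=
  P.diagram =
    Set.range fun t => (ratOfCode (f t).1, (f t).2.1, (f t).2.2.1, ratOfCode (f t).2.2.2)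

/-- A presentation is computable if it has a computable name. -/
def IsComputable {X : Type*} [TopologicalSpace X] (P : Presentation X) : Prop :=
  ∃ f : ℕ → (ℕ × ℕ × ℕ) × ℕ × ℕ × (ℕ × ℕ × ℕ), Computable f ∧ P.IsName f

/-- `f` is a total boundedness function: for each `j`, the open balls of radius `2⁻ʲ` around the
distinguished points with indices in the finite set listed by `f j` cover the space. -/
def IsTotalBoundednessFunction {X : Type*} [TopologicalSpace X] (P : Presentation X)
    (f : ℕ → List ℕ) : Prop :=
  ∀ (j : ℕ) (x : X), ∃ k ∈ f j, P.d (P.pts k) x < (1 / 2 : ℝ) ^ j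

/-- A presentation is computably compact if it is computable and has a computable total
boundedness function. -/
def IsComputablyCompact {X : Type*} [TopologicalSpace X] (P : Presentation X) : Prop :=
  P.IsComputable ∧ ∃ f : ℕ → List ℕ, Computable f ∧ P.IsTotalBoundednessFunction f

/-- `ρ` is a (Cauchy) name of the point `x`: `d(p_{ρ(k)}, x) < 2⁻ᵏ` for all `k`. -/
def IsPointName {X : Type*} [TopologicalSpace X] (P : Presentation X) (ρ : ℕ → ℕ) (x : X) : Prop :=
  ∀ k : ℕ, P.d (P.pts (ρ k)) x < (1 / 2 : ℝ) ^ k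

end Presentation

/-- The partial recursive functionals `Φ(g; n)`, with a function oracle `g : ℕ → ℕ`. This is the
uniform version of `Nat.RecursiveIn`: a single program works for all oracles. -/
inductive RecursiveFunctional : ((ℕ → ℕ) → ℕ →. ℕ) → Prop
  | zero : RecursiveFunctional fun _ _ => Part.some 0
  | succ : RecursiveFunctional fun _ n => Part.some (n + 1)
  | left : RecursiveFunctional fun _ n => Part.some n.unpair.1
  | right : RecursiveFunctional fun _ n => Part.some n.unpair.2
  | oracle : RecursiveFunctional fun g n => Part.some (g n)
  | pair {Φ Ψ : (ℕ → ℕ) → ℕ →. ℕ} (hΦ : RecursiveFunctional Φ) (hΨ : RecursiveFunctional Ψ) :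
      RecursiveFunctional fun g n => (Φ g n).bind fun a => (Ψ g n).map fun b => Nat.pair a b
  | comp {Φ Ψ : (ℕ → ℕ) → ℕ →. ℕ} (hΦ : RecursiveFunctional Φ) (hΨ : RecursiveFunctional Ψ) :
      RecursiveFunctional fun g n => (Ψ g n).bind fun a => Φ g a
  | prec {Φ Ψ : (ℕ → ℕ) → ℕ →. ℕ} (hΦ : RecursiveFunctional Φ) (hΨ : RecursiveFunctional Ψ) :
      RecursiveFunctional fun g n =>
        Nat.rec (motive := fun _ => Part ℕ) (Φ g n.unpair.1)
          (fun y ih => ih.bind fun i => Ψ g (Nat.pair n.unpair.1 (Nat.pair y i))) n.unpair.2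
  | rfind {Φ : (ℕ → ℕ) → ℕ →. ℕ} (hΦ : RecursiveFunctional Φ) :
      RecursiveFunctional fun g n =>
        Nat.rfind fun m => (Φ g (Nat.pair n m)).map fun v => decide (v = 0)

namespace Presentation

/-- `h` is a computable map from `P` to `Q`: one and the same algorithm, given any name of any
point `x` (as an oracle), computes a name of `h x`. -/
def IsComputableMap {X Y : Type*} [TopologicalSpace X] [TopologicalSpace Y]
    (P : Presentation X) (Q : Presentation Y) (h : X → Y) : Prop :=
  ∃ Φ : (ℕ → ℕ) → ℕ →. ℕ, RecursiveFunctional Φ ∧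
    ∀ (x : X) (ρ : ℕ → ℕ), P.IsPointName ρ x →
      ∃ τ : ℕ → ℕ, (∀ n : ℕ, Φ ρ n = Part.some (τ n)) ∧ Q.IsPointName τ (h x)

/-- Two presentations are computably homeomorphic if there is a homeomorphism that is computable
in both directions. -/
def ComputablyHomeomorphic {X Y : Type*} [TopologicalSpace X] [TopologicalSpace Y]
    (P : Presentation X) (Q : Presentation Y) : Prop :=
  ∃ h : X ≃ₜ Y, P.IsComputableMap Q h ∧ Q.IsComputableMap P h.symm

end Presentation

/-! The homeomorphism is the limit of finite approximations. Stage `n` is a list of pairs of indices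
with one radius `2⁻ʲ`, read as pairs of balls, one in each space. If the stages cover both spaces,
if any two pairs of stage `n` are either formally disjoint in both spaces or `2⁻ⁿ`-close in both,
and if each stage formally refines the one before, then "every stage has a pair of balls around `x`
and `y`" is the graph of a homeomorphism (`IsMatching.exists_homeomorph`). It is computable: once a
ball around `x` is found in stage `n`, the partner of its centre is `2⁻ⁿ`-close to the image of `x`
(`IsMatching.d_lt`).

The topology of Cantor space enters only in the existence of the next stage (`exists_refinement`).
Take words so long that their cylinders are small in both metrics, and let `A` be the finite set of
pairs of words whose cylinders fit inside a common pair of the given stage. Both projections of `A`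
to words are onto, so, as every cylinder splits into any finite number of nonempty clopen pieces,
both spaces map continuously onto `A` compatibly with the projections. Pairing centres with equal
values in `A` gives the next stage.

The remaining conditions are strict inequalities between distances of distinguished points, hence
recognizable from the diagrams, and covering is ensured by listing all indices given by the total
boundedness functions. An unbounded search therefore computes a sequence of stages
(`exists_computable_isMatching`). -/

namespace Presentation

/-! ### Metric and compactness facts for a presentation -/

section Metric

variable {X : Type*} [TopologicalSpace X] (P : Presentation X)

/-- The metric of a presentation, with the given topology as its underlying topology. -/
abbrev metricSpace : MetricSpace X := P.metric.replaceTopology P.compatible.symm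

theorem d_self (x : X) : P.d x x = 0 := P.metric.dist_self x

theorem d_comm (x y : X) : P.d x y = P.d y x := P.metric.dist_comm x y

theorem d_triangle (x y z : X) : P.d x z ≤ P.d x y + P.d y z := P.metric.dist_triangle x y z

theorem d_nonneg (x y : X) : 0 ≤ P.d x y :=
  @dist_nonneg X P.metric.toPseudoMetricSpace x y

theorem eq_of_d_eq_zero {x y : X} (h : P.d x y = 0) : x = y := P.metric.eq_of_dist_eq_zero h

theorem continuous_d (a : X) : Continuous fun x => P.d a x := by
  let _ := P.metricSpace
  exact (continuous_const.dist continuous_id : Continuous fun x => dist a x)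

theorem exists_d_lt_subset {x : X} {s : Set X} (hs : s ∈ nhds x) :
    ∃ ε > 0, ∀ y, P.d x y < ε → y ∈ s := by
  let _ := P.metricSpace
  obtain ⟨ε, hε, h⟩ := Metric.mem_nhds_iff.1 hs
  refine ⟨ε, hε, fun y hy => h ?_⟩
  rw [Metric.mem_ball, dist_comm]
  exact hy

/-- A continuous map from a compact space to a discrete one is constant at small distances. -/
theorem exists_pos_forall_d_lt_eq [CompactSpace X] {A : Type*} [TopologicalSpace A]
    [DiscreteTopology A] {u : X → A} (hu : Continuous u) :
    ∃ δ > 0, ∀ x y, P.d x y < δ → u x = u y := by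
  let _ := P.metricSpace
  obtain ⟨δ, hδ, h⟩ := lebesgue_number_lemma_of_metric (c := fun a => u ⁻¹' {a}) isCompact_univ
    (fun a => (isOpen_discrete _).preimage hu) (fun x _ => Set.mem_iUnion.2 ⟨u x, rfl⟩)
  refine ⟨δ, hδ, fun x y hxy => ?_⟩
  obtain ⟨a, ha⟩ := h x trivial
  have hx : u x = a := ha (Metric.mem_ball_self hδ)
  have hy : u y = a := ha (by rw [Metric.mem_ball, dist_comm]; exact hxy)
  rw [hx, hy]

/-- In a compact space, finitely many open balls that cover still cover when shrunk a little. -/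
theorem exists_uniform_slack [CompactSpace X] {ι : Type*} (s : Set ι) (c : ι → X) {r : ℝ}
    (h : ∀ x, ∃ e ∈ s, P.d (c e) x < r) :
    ∃ i : ℕ, ∀ x, ∃ e ∈ s, P.d (c e) x + (1 / 2 : ℝ) ^ i < r := by
  obtain ⟨i, hi⟩ := isCompact_univ.elim_directed_cover
    (fun i : ℕ => ⋃ e ∈ s, {x | P.d (c e) x + (1 / 2 : ℝ) ^ i < r})
    (fun i => isOpen_biUnion fun e _ =>
      isOpen_lt ((P.continuous_d _).add continuous_const) continuous_const)
    (fun x _ => by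
      obtain ⟨e, he, hx⟩ := h x
      obtain ⟨i, hi⟩ := exists_pow_lt_of_lt_one (sub_pos.2 hx) (by norm_num : (1 / 2 : ℝ) < 1)
      simp only [Set.mem_iUnion]
      exact ⟨i, e, he, by simp only [Set.mem_ofPred_eq]; linarith⟩)
    (Monotone.directed_le fun i i' hii' => Set.biUnion_mono subset_rfl fun e _ x hx => by
      have : (1 / 2 : ℝ) ^ i' ≤ (1 / 2) ^ i :=
        pow_le_pow_of_le_one (by norm_num) (by norm_num) hii'
      simp only [Set.mem_ofPred_eq] at hx ⊢
      linarith)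
  refine ⟨i, fun x => ?_⟩
  have := hi (Set.mem_univ x)
  simpa using this

end Metric

/-! ### From a matching to a homeomorphism -/

section Matching

variable {X Y : Type*} [TopologicalSpace X] [TopologicalSpace Y]

/-- The pairs in `R` list centres of balls of radius `2⁻ʲ` that cover both spaces. -/
def Covers (P : Presentation X) (Q : Presentation Y) (j : ℕ) (R : List (ℕ × ℕ)) : Prop :=
  (∀ x, ∃ e ∈ R, P.d (P.pts e.1) x < (1 / 2 : ℝ) ^ j) ∧
    ∀ y, ∃ e ∈ R, Q.d (Q.pts e.2) y < (1 / 2 : ℝ) ^ j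

/-- Any two pairs in `R` are far apart in both spaces, or closer than `2⁻ⁿ` in both spaces. -/
def Separates (P : Presentation X) (Q : Presentation Y) (n j : ℕ) (R : List (ℕ × ℕ)) : Prop :=
  ∀ e ∈ R, ∀ e' ∈ R,
    (2 * (1 / 2 : ℝ) ^ j < P.d (P.pts e.1) (P.pts e'.1) ∧
      2 * (1 / 2 : ℝ) ^ j < Q.d (Q.pts e.2) (Q.pts e'.2)) ∨
    (P.d (P.pts e.1) (P.pts e'.1) + (1 / 2 : ℝ) ^ j < (1 / 2 : ℝ) ^ n ∧
      Q.d (Q.pts e.2) (Q.pts e'.2) + (1 / 2 : ℝ) ^ j < (1 / 2 : ℝ) ^ n)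

/-- The balls of radius `2⁻ʲ'` given by each pair in `R'` are formally inside the balls of radius
`2⁻ʲ` given by some pair in `R`. -/
def Refines (P : Presentation X) (Q : Presentation Y) (j : ℕ) (R : List (ℕ × ℕ)) (j' : ℕ)
    (R' : List (ℕ × ℕ)) : Prop :=
  ∀ e' ∈ R', ∃ e ∈ R,
    P.d (P.pts e'.1) (P.pts e.1) + (1 / 2 : ℝ) ^ j' < (1 / 2 : ℝ) ^ j ∧
      Q.d (Q.pts e'.2) (Q.pts e.2) + (1 / 2 : ℝ) ^ j' < (1 / 2 : ℝ) ^ j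

/-- A sequence of finite approximations to a homeomorphism between two presentations. -/
structure IsMatching (P : Presentation X) (Q : Presentation Y) (j : ℕ → ℕ)
    (R : ℕ → List (ℕ × ℕ)) : Prop where
  covers : ∀ n, Covers P Q (j n) (R n)
  separates : ∀ n, Separates P Q n (j n) (R n)
  refines : ∀ n, Refines P Q (j n) (R n) (j (n + 1)) (R (n + 1))

/-- The graph of the map approximated by a matching. -/
def MatchingGraph (P : Presentation X) (Q : Presentation Y) (j : ℕ → ℕ)
    (R : ℕ → List (ℕ × ℕ)) (x : X) (y : Y) : Prop :=
  ∀ n, ∃ e ∈ R n, P.d (P.pts e.1) x < (1 / 2 : ℝ) ^ j n ∧ Q.d (Q.pts e.2) y < (1 / 2 : ℝ) ^ j n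

variable {P : Presentation X} {Q : Presentation Y} {j : ℕ → ℕ} {R : ℕ → List (ℕ × ℕ)}

theorem IsMatching.swap (h : IsMatching P Q j R) :
    IsMatching Q P j fun n => (R n).map Prod.swap where
  covers n := by
    have := h.covers n
    simp only [Covers, List.mem_map, exists_exists_and_eq_and, Prod.fst_swap, Prod.snd_swap] at this ⊢
    exact this.symm
  separates n := by
    have := h.separates n
    simp only [Separates, List.mem_map, forall_exists_index, and_imp,
      forall_apply_eq_imp_iff₂, Prod.fst_swap, Prod.snd_swap] at this ⊢
    exact fun e he e' he' => (this e he e' he').imp And.symm And.symm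
  refines n := by
    have := h.refines n
    simp only [Refines, List.mem_map, forall_exists_index, and_imp,
      forall_apply_eq_imp_iff₂, exists_exists_and_eq_and, Prod.fst_swap, Prod.snd_swap] at this ⊢
    exact fun e he => (this e he).imp fun e' h => ⟨h.1, h.2.symm⟩

theorem matchingGraph_swap {x : X} {y : Y} :
    MatchingGraph Q P j (fun n => (R n).map Prod.swap) y x ↔ MatchingGraph P Q j R x y := by
  simp only [MatchingGraph, List.mem_map, exists_exists_and_eq_and, Prod.fst_swap, Prod.snd_swap]
  exact forall_congr' fun n => exists_congr fun e => and_congr_right' and_comm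

/-- The pair that witnesses stage `n` for `x` and `y` also has its first ball around `x`. Two balls
with a common point cannot have far centres, so separation makes the second centres close. -/
theorem IsMatching.d_lt (h : IsMatching P Q j R) {n : ℕ} {e : ℕ × ℕ} (he : e ∈ R n) {x : X}
    {y : Y} (hx : P.d (P.pts e.1) x < (1 / 2 : ℝ) ^ j n) (hxy : MatchingGraph P Q j R x y) :
    Q.d (Q.pts e.2) y < (1 / 2 : ℝ) ^ n := by
  obtain ⟨e', he', hx', hy'⟩ := hxy n
  have h₁ := P.d_triangle (P.pts e.1) x (P.pts e'.1)
  have h₂ := Q.d_triangle (Q.pts e.2) (Q.pts e'.2) y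
  rw [P.d_comm x (P.pts e'.1)] at h₁
  rcases h.separates n e he e' he' with hfar | hnear
  · linarith [hfar.1]
  · linarith [hnear.2]

theorem IsMatching.existsUnique [CompactSpace Y] (h : IsMatching P Q j R) (x : X) :
    ∃! y, MatchingGraph P Q j R x y := by
  apply existsUnique_of_exists_of_unique
  -- Closed balls serve for compactness; the strict slack in `refines` puts a closed ball of stage
  -- `n + 1` inside an open one of stage `n`, so the sets are nested and nothing is lost in the
  -- limit.
  · let F : ℕ → Set Y := fun n => ⋃ e ∈ {e | e ∈ R n ∧ P.d (P.pts e.1) x < (1 / 2 : ℝ) ^ j n},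
      {y | Q.d (Q.pts e.2) y ≤ (1 / 2 : ℝ) ^ j n}
    have hmem : ∀ n y, y ∈ F (n + 1) → ∃ e ∈ R n,
        P.d (P.pts e.1) x < (1 / 2 : ℝ) ^ j n ∧ Q.d (Q.pts e.2) y < (1 / 2 : ℝ) ^ j n := by
      intro n y hy
      simp only [F, Set.mem_iUnion, Set.mem_ofPred_eq, exists_prop] at hy
      obtain ⟨e', ⟨he', hx⟩, hy⟩ := hy
      obtain ⟨e, he, hP, hQ⟩ := h.refines n e' he'
      have h₁ := P.d_triangle (P.pts e.1) (P.pts e'.1) x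
      have h₂ := Q.d_triangle (Q.pts e.2) (Q.pts e'.2) y
      rw [P.d_comm (P.pts e.1) (P.pts e'.1)] at h₁
      rw [Q.d_comm (Q.pts e.2) (Q.pts e'.2)] at h₂
      exact ⟨e, he, by linarith, by linarith⟩
    have hclosed : ∀ n, IsClosed (F n) := fun n =>
      ((List.finite_toSet (R n)).subset fun e he => he.1).isClosed_biUnion fun e _ =>
        isClosed_le (Q.continuous_d _) continuous_const
    obtain ⟨y, hy⟩ := IsCompact.nonempty_iInter_of_sequence_nonempty_isCompact_isClosed F
      (fun n y hy => by
        obtain ⟨e, he, h₁, h₂⟩ := hmem n y hy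
        simp only [F, Set.mem_iUnion, Set.mem_ofPred_eq, exists_prop]
        exact ⟨e, ⟨he, h₁⟩, h₂.le⟩)
      (fun n => by
        obtain ⟨e, he, hx⟩ := (h.covers n).1 x
        refine ⟨Q.pts e.2, ?_⟩
        simp only [F, Set.mem_iUnion, Set.mem_ofPred_eq, exists_prop]
        exact ⟨e, ⟨he, hx⟩, by rw [Q.d_self]; positivity⟩)
      (hclosed 0).isCompact hclosed
    exact ⟨y, fun n => hmem n y (Set.mem_iInter.1 hy (n + 1))⟩
  · intro y y' hy hy'
    refine Q.eq_of_d_eq_zero (le_antisymm (le_of_forall_pos_lt_add fun ε hε => ?_) (Q.d_nonneg _ _))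
    obtain ⟨n, hn⟩ := exists_pow_lt_of_lt_one (half_pos hε) (by norm_num : (1 / 2 : ℝ) < 1)
    obtain ⟨e, he, hx⟩ := (h.covers n).1 x
    have h₁ := h.d_lt he hx hy
    have h₂ := h.d_lt he hx hy'
    have h₃ := Q.d_triangle y (Q.pts e.2) y'
    rw [Q.d_comm y (Q.pts e.2)] at h₃
    linarith

theorem IsMatching.continuous (h : IsMatching P Q j R) {f : X → Y}
    (hf : ∀ x, MatchingGraph P Q j R x (f x)) : Continuous f := by
  rw [continuous_iff_continuousAt]
  intro x s hs
  obtain ⟨ε, hε, hεs⟩ := Q.exists_d_lt_subset hs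
  obtain ⟨n, hn⟩ := exists_pow_lt_of_lt_one (half_pos hε) (by norm_num : (1 / 2 : ℝ) < 1)
  obtain ⟨e, he, hx⟩ := (h.covers n).1 x
  rw [Filter.mem_map]
  filter_upwards [(isOpen_lt (P.continuous_d (P.pts e.1)) continuous_const).mem_nhds hx] with x' hx'
  apply hεs
  have h₁ := h.d_lt he hx (hf x)
  have h₂ := h.d_lt he hx' (hf x')
  have h₃ := Q.d_triangle (f x) (Q.pts e.2) (f x')
  rw [Q.d_comm (f x) (Q.pts e.2)] at h₃
  linarith

theorem IsMatching.exists_homeomorph [CompactSpace X] [CompactSpace Y] (h : IsMatching P Q j R) :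
    ∃ f : X ≃ₜ Y, ∀ x, MatchingGraph P Q j R x (f x) := by
  have hX := h.existsUnique
  have hY : ∀ y, ∃! x, MatchingGraph P Q j R x y := fun y => by
    simpa only [matchingGraph_swap] using h.swap.existsUnique y
  choose f hf huniq using hX
  choose g hg hguniq using hY
  exact ⟨{  toFun := f
            invFun := g
            left_inv := fun x => (hguniq _ _ (hf x)).symm
            right_inv := fun y => (huniq _ _ (hg y)).symm
            continuous_toFun := h.continuous hf
            continuous_invFun := h.swap.continuous fun y => matchingGraph_swap.2 (hg y) }, hf⟩

end Matching

/-! ### Existence of the next stage in Cantor space -/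

section Cantor

/-- The metric of `P` is arbitrary, but by compactness a cover by its small balls has a Lebesgue
number for the standard metric, in which long cylinders are small. -/
theorem exists_forall_agree_d_lt (P : Presentation (ℕ → Bool)) {ε : ℝ} (hε : 0 < ε) :
    ∃ N : ℕ, ∀ M, N ≤ M → ∀ x y : ℕ → Bool, (∀ i < M, x i = y i) → P.d x y < ε := by
  let : MetricSpace (ℕ → Bool) := PiNat.metricSpace
  obtain ⟨δ, hδ, h⟩ := lebesgue_number_lemma_of_metric
    (c := fun a => {x | P.d a x < ε / 2}) (isCompact_univ (X := ℕ → Bool))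
    (fun a => isOpen_lt (P.continuous_d a) continuous_const)
    (fun x _ => Set.mem_iUnion.2 ⟨x, by
      simp only [Set.mem_ofPred_eq, P.d_self]
      linarith⟩)
  obtain ⟨N, hN⟩ := exists_pow_lt_of_lt_one hδ (by norm_num : (1 / 2 : ℝ) < 1)
  refine ⟨N, fun M hM x y hxy => ?_⟩
  obtain ⟨a, ha⟩ := h x trivial
  have hx : P.d a x < ε / 2 := ha (Metric.mem_ball_self hδ)
  have hy : P.d a y < ε / 2 := ha <| Metric.mem_ball.2 <|
    (PiNat.mem_cylinder_iff_dist_le.1 <| PiNat.mem_cylinder_iff.2 fun i hi =>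
      (hxy i (hi.trans_le hM)).symm).trans_lt hN
  have := P.d_triangle x a y
  rw [P.d_comm x a] at this
  linarith

/-- A map from a finite set onto the words of length `N` lifts the restriction map of Cantor
space to a continuous surjection. -/
theorem exists_continuous_surjective_lift {A : Type} [Finite A] [TopologicalSpace A]
    [DiscreteTopology A] {N : ℕ} {π : A → Fin N → Bool} (hπ : Function.Surjective π) :
    ∃ u : (ℕ → Bool) → A, Continuous u ∧ Function.Surjective u ∧
      ∀ x, π (u x) = fun i : Fin N => x i := by
  classical
  obtain ⟨a₀, -⟩ := hπ fun _ => false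
  have : Nonempty A := ⟨a₀⟩
  let : MetricSpace A := TopologicalSpace.metrizableSpaceMetric A
  obtain ⟨g, hg, hgs⟩ := exists_nat_bool_continuous_surjective_of_compact A
  -- The first `N` bits prescribe the word, the other bits propose a point of `A` through `g`; a
  -- proposal over the wrong word is replaced by a default over the right one.
  let G : (Fin N → Bool) × A → A := fun p => if π p.2 = p.1 then p.2 else (hπ p.1).choose
  refine ⟨fun x => G (fun i => x i, g fun i => x (i + N)), ?_, fun a => ?_, fun x => ?_⟩
  · have hc : Continuous fun x : ℕ → Bool => ((fun i : Fin N => x i), g fun i => x (i + N)) := by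
      fun_prop
    exact (continuous_of_discreteTopology (f := G)).comp hc
  · obtain ⟨t, rfl⟩ := hgs a
    refine ⟨fun i => if hi : i < N then π (g t) ⟨i, hi⟩ else t (i - N), ?_⟩
    simp [G]
  · simp only [G]
    split_ifs with h
    · exact h
    · exact (hπ _).choose_spec

theorem exists_refinement {P Q : Presentation (ℕ → Bool)} {f g : ℕ → List ℕ}
    (hf : P.IsTotalBoundednessFunction f) (hg : Q.IsTotalBoundednessFunction g) {j : ℕ}
    {R : List (ℕ × ℕ)} (hR : Covers P Q j R) (n : ℕ) :
    ∃ j' R', (∀ k ∈ f j', ∃ e ∈ R', e.1 = k) ∧ (∀ l ∈ g j', ∃ e ∈ R', e.2 = l) ∧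
      Separates P Q n j' R' ∧ Refines P Q j R j' R' := by
  classical
  have mono : ∀ {a b : ℕ}, a ≤ b → (1 / 2 : ℝ) ^ b ≤ (1 / 2) ^ a := fun h =>
    pow_le_pow_of_le_one (by norm_num) (by norm_num) h
  obtain ⟨i₁, hi₁⟩ := P.exists_uniform_slack {e | e ∈ R} (fun e => P.pts e.1) hR.1
  obtain ⟨i₂, hi₂⟩ := Q.exists_uniform_slack {e | e ∈ R} (fun e => Q.pts e.2) hR.2
  set i := max (max i₁ i₂) n with hi
  -- The slack `2η` is spent in two halves: one for the diameter of a cylinder, one for the radius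
  -- of the new balls.
  set η : ℝ := (1 / 2) ^ (i + 1) with hη
  have hη0 : 0 < η := by positivity
  have h2η : 2 * η = (1 / 2) ^ i := by rw [hη, pow_succ]; ring
  have hηi₁ : 2 * η ≤ (1 / 2) ^ i₁ := h2η ▸ mono (by omega)
  have hηi₂ : 2 * η ≤ (1 / 2) ^ i₂ := h2η ▸ mono (by omega)
  have hηn : 2 * η ≤ (1 / 2) ^ n := h2η ▸ mono (by omega)
  obtain ⟨N₁, hN₁⟩ := P.exists_forall_agree_d_lt hη0
  obtain ⟨N₂, hN₂⟩ := Q.exists_forall_agree_d_lt hη0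
  set N := max N₁ N₂ with hN
  let r : (ℕ → Bool) → Fin N → Bool := fun x i => x i
  have hr : Function.Surjective r := fun σ =>
    ⟨fun i => if hi : i < N then σ ⟨i, hi⟩ else false, by simp [r]⟩
  have hP : ∀ x y, r x = r y → P.d x y < η := fun x y h =>
    hN₁ N (le_max_left _ _) x y fun i hi => congrFun h ⟨i, hi⟩
  have hQ : ∀ x y, r x = r y → Q.d x y < η := fun x y h =>
    hN₂ N (le_max_right _ _) x y fun i hi => congrFun h ⟨i, hi⟩
  let A := {p : (Fin N → Bool) × (Fin N → Bool) // ∃ e ∈ R,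
    (∀ x, r x = p.1 → P.d (P.pts e.1) x + η < (1 / 2 : ℝ) ^ j) ∧
      ∀ y, r y = p.2 → Q.d (Q.pts e.2) y + η < (1 / 2 : ℝ) ^ j}
  let : TopologicalSpace A := ⊥
  have : DiscreteTopology A := ⟨rfl⟩
  have hA₁ : Function.Surjective fun a : A => a.1.1 := by
    intro σ
    obtain ⟨x, rfl⟩ := hr σ
    obtain ⟨e, he, hx⟩ := hi₁ x
    -- Any word has a partner: that of the other centre of a pair whose first ball contains `x` with
    -- slack.
    refine ⟨⟨(r x, r (Q.pts e.2)), e, he, fun x' hx' => ?_, fun y hy => ?_⟩, rfl⟩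
    · have := hP x x' hx'.symm
      have := P.d_triangle (P.pts e.1) x x'
      linarith
    · have := hQ _ _ hy.symm
      have := P.d_nonneg (P.pts e.1) x
      linarith
  have hA₂ : Function.Surjective fun a : A => a.1.2 := by
    intro σ
    obtain ⟨y, rfl⟩ := hr σ
    obtain ⟨e, he, hy⟩ := hi₂ y
    refine ⟨⟨(r (P.pts e.1), r y), e, he, fun x hx => ?_, fun y' hy' => ?_⟩, rfl⟩
    · have := hP _ _ hx.symm
      have := Q.d_nonneg (Q.pts e.2) y
      linarith
    · have := hQ y y' hy'.symm
      have := Q.d_triangle (Q.pts e.2) y y'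
      linarith
  obtain ⟨u, hu, hus, hur⟩ := exists_continuous_surjective_lift hA₁
  obtain ⟨v, hv, hvs, hvr⟩ := exists_continuous_surjective_lift hA₂
  obtain ⟨δ₁, hδ₁, huδ⟩ := P.exists_pos_forall_d_lt_eq hu
  obtain ⟨δ₂, hδ₂, hvδ⟩ := Q.exists_pos_forall_d_lt_eq hv
  obtain ⟨m, hm⟩ := exists_pow_lt_of_lt_one (lt_min hδ₁ hδ₂) (by norm_num : (1 / 2 : ℝ) < 1)
  obtain ⟨hm₁, hm₂⟩ := lt_min_iff.1 hm
  -- The first bound makes the radius at most `η`; the second makes its double less than `δ₁` and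
  -- `δ₂`, so centres with different values in `A` are far apart.
  set j' := max (i + 1) (m + 1) with hj'
  have hj'η : (1 / 2 : ℝ) ^ j' ≤ η := mono (le_max_left _ _)
  have hj'm : 2 * (1 / 2 : ℝ) ^ j' ≤ (1 / 2) ^ m := by
    have := mono (le_max_right (i + 1) (m + 1))
    rw [pow_succ] at this
    linarith
  have hj'0 : (0 : ℝ) < (1 / 2) ^ j' := by positivity
  refine ⟨j', ((f j').product (g j')).filter fun e => u (P.pts e.1) = v (Q.pts e.2),
    fun k hk => ?_, fun l hl => ?_, fun e he e' he' => ?_, fun e he => ?_⟩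
  -- Surjectivity of `v` supplies a partner for every index: the value is attained at some `y`,
  -- hence also at a centre near `y`.
  · obtain ⟨y, hy⟩ := hvs (u (P.pts k))
    obtain ⟨l, hl, hly⟩ := hg j' y
    refine ⟨(k, l), ?_, rfl⟩
    simp only [List.mem_filter, decide_eq_true_eq, List.pair_mem_product]
    exact ⟨⟨hk, hl⟩, by rw [hvδ _ _ (by linarith : Q.d (Q.pts l) y < δ₂), hy]⟩
  · obtain ⟨x, hx⟩ := hus (v (Q.pts l))
    obtain ⟨k, hk, hkx⟩ := hf j' x
    refine ⟨(k, l), ?_, rfl⟩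
    simp only [List.mem_filter, decide_eq_true_eq, List.pair_mem_product]
    exact ⟨⟨hk, hl⟩, by rw [huδ _ _ (by linarith : P.d (P.pts k) x < δ₁), hx]⟩
  · simp only [List.mem_filter, decide_eq_true_eq] at he he'
    by_cases h : u (P.pts e.1) = u (P.pts e'.1)
    · right
      have h₁ : r (P.pts e.1) = r (P.pts e'.1) := by
        have := congrArg (fun a : A => a.1.1) h
        simpa only [hur] using this
      have h₂ : r (Q.pts e.2) = r (Q.pts e'.2) := by
        rw [he.2, he'.2] at h
        have := congrArg (fun a : A => a.1.2) h
        simpa only [hvr] using this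
      exact ⟨by linarith [hP _ _ h₁], by linarith [hQ _ _ h₂]⟩
    · left
      have h₁ := mt (huδ _ _) h
      rw [he.2, he'.2] at h
      have h₂ := mt (hvδ _ _) h
      exact ⟨by linarith, by linarith⟩
  · simp only [List.mem_filter, decide_eq_true_eq] at he
    obtain ⟨e₀, he₀, h₁, h₂⟩ := (u (P.pts e.1)).2
    refine ⟨e₀, he₀, ?_, ?_⟩
    · have := h₁ (P.pts e.1) (hur _).symm
      rw [P.d_comm] at this
      linarith
    · have := h₂ (Q.pts e.2) (by rw [he.2]; exact (hvr _).symm)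
      rw [Q.d_comm] at this
      linarith

end Cantor

end Presentation

-- Computable checks and unbounded search

attribute [fun_prop] Computable

namespace Computable

variable {α β γ σ : Type*} [Primcodable α] [Primcodable β] [Primcodable γ] [Primcodable σ]

@[fun_prop]
theorem id_fun : Computable fun a : α => a := Computable.id

@[fun_prop]
theorem comp_fun {f : β → γ} {g : α → β} (hf : Computable f) (hg : Computable g) :
    Computable fun a => f (g a) := hf.comp hg

attribute [fun_prop] Computable.const Computable.pair

@[fun_prop]
theorem fst_fun {f : α → β × γ} (hf : Computable f) : Computable fun a => (f a).1 := fst.comp hf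

@[fun_prop]
theorem snd_fun {f : α → β × γ} (hf : Computable f) : Computable fun a => (f a).2 := snd.comp hf

@[fun_prop]
theorem nat_add {f g : α → ℕ} (hf : Computable f) (hg : Computable g) :
    Computable fun a => f a + g a :=
  Primrec.nat_add.to_comp.comp hf hg

@[fun_prop]
theorem nat_mul {f g : α → ℕ} (hf : Computable f) (hg : Computable g) :
    Computable fun a => f a * g a :=
  Primrec.nat_mul.to_comp.comp hf hg

@[fun_prop]
theorem nat_pow {f g : α → ℕ} (hf : Computable f) (hg : Computable g) :
    Computable fun a => f a ^ g a :=
  (Primrec₂.unpaired'.1 Nat.Primrec.pow).to_comp.comp hf hg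

@[fun_prop]
theorem nat_le {f g : α → ℕ} (hf : Computable f) (hg : Computable g) :
    Computable fun a => decide (f a ≤ g a) :=
  Primrec.nat_le.decide.to_comp.comp hf hg

@[fun_prop]
theorem nat_eq {f g : α → ℕ} (hf : Computable f) (hg : Computable g) :
    Computable fun a => decide (f a = g a) :=
  Primrec.eq.decide.to_comp.comp hf hg

@[fun_prop]
theorem bool_and {f g : α → Bool} (hf : Computable f) (hg : Computable g) :
    Computable fun a => f a && g a :=
  Primrec.and.to_comp.comp hf hg

@[fun_prop]
theorem bool_or {f g : α → Bool} (hf : Computable f) (hg : Computable g) :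
    Computable fun a => f a || g a :=
  Primrec.or.to_comp.comp hf hg

@[fun_prop]
theorem bool_not {f : α → Bool} (hf : Computable f) : Computable fun a => !f a :=
  Primrec.not.to_comp.comp hf

@[fun_prop]
theorem list_all {l : α → List β} {p : α → β → Bool} (hl : Computable l)
    (hp : Computable fun x : α × β => p x.1 x.2) : Computable fun a => (l a).all (p a) := by
  -- Recursion on the length of the prefix already tested; the default `true` leaves the conjunction
  -- unchanged at an index out of range.
  have h : Computable fun a => Nat.rec (motive := fun _ => Bool) true
      (fun i acc => acc && (((l a)[i]?).map (p a)).getD true) (l a).length := by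
    refine nat_rec (h := fun a x => x.2 && (((l a)[x.1]?).map (p a)).getD true)
      (list_length.comp hl) (const true) ?_
    refine Primrec.and.to_comp.comp (snd.comp snd)
      (Primrec.option_getD.to_comp.comp (option_map ?_ ?_) (const true))
    · exact list_getElem?.comp (hl.comp fst) (fst.comp snd)
    · exact hp.comp (pair (fst.comp fst) snd)
  refine h.of_eq fun a => ?_
  have key : ∀ n, Nat.rec (motive := fun _ => Bool) true
      (fun i acc => acc && (((l a)[i]?).map (p a)).getD true) n = ((l a).take n).all (p a) := by
    intro n
    induction n with
    | zero => simp
    | succ n ih =>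
      rw [List.take_add_one, List.all_append, ← ih]
      cases h : (l a)[n]? <;> simp [h]
  rw [key, List.take_length]

@[fun_prop]
theorem list_any {l : α → List β} {p : α → β → Bool} (hl : Computable l)
    (hp : Computable fun x : α × β => p x.1 x.2) : Computable fun a => (l a).any (p a) := by
  refine (bool_not (list_all (p := fun a b => !p a b) hl (by fun_prop))).of_eq fun a => ?_
  rw [Bool.eq_iff_iff]
  simp

/-- Unbounded search for a witness of a computable property is computable. -/
theorem exists_of_forall_exists {p : α → β → Bool} (hp : Computable fun x : α × β => p x.1 x.2)
    (h : ∀ a, ∃ b, p a b = true) : ∃ g : α → β, Computable g ∧ ∀ a, p a (g a) = true := by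
  let q : α → ℕ → Option β := fun a n =>
    (Encodable.decode (α := β) n).bind fun b => bif p a b then some b else none
  have hq : Computable₂ q := bind_decode_iff.2
    (Computable.cond hp (option_some.comp snd) (const none))
  have hdom : ∀ a, (Nat.rfindOpt (q a)).Dom := fun a => by
    obtain ⟨b, hb⟩ := h a
    exact Nat.rfindOpt_dom.2 ⟨Encodable.encode b, b, by simp [q, hb]⟩
  refine ⟨fun a => (Nat.rfindOpt (q a)).get (hdom a),
    (Partrec.rfindOpt hq).of_eq_tot fun a => Part.get_mem _, fun a => ?_⟩
  obtain ⟨n, hn⟩ := Nat.rfindOpt_spec (Part.get_mem (hdom a))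
  obtain ⟨b, -, hb⟩ := Option.bind_eq_some_iff.1 hn
  cases hpb : p a b <;> simp only [hpb, cond_true, cond_false, Option.some.injEq,
    reduceCtorEq] at hb
  change p a ((Nat.rfindOpt (q a)).get (hdom a)) = true
  rw [← hb]
  exact hpb

end Computable

/-! ### Search with an oracle -/

namespace RecursiveFunctional

theorem of_partrec {f : ℕ →. ℕ} (hf : Nat.Partrec f) : RecursiveFunctional fun _ => f := by
  induction hf with
  | zero => exact .zero
  | succ => exact .succ
  | left => exact .left
  | right => exact .right
  | pair _ _ ihf ihg =>
    convert ihf.pair ihg using 3 with g n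
    simp [Seq.seq, Part.bind_map, Part.map_eq_map]
  | comp _ _ ihf ihg => exact ihf.comp ihg
  | prec _ _ ihf ihg => exact ihf.prec ihg
  | rfind _ ihf => exact ihf.rfind

theorem of_computable {f : ℕ → ℕ} (hf : Computable f) :
    RecursiveFunctional fun _ n => Part.some (f n) :=
  of_partrec (Partrec.nat_iff.1 hf)

/-- Search, with an oracle `ρ`, for a pair `(m, b)` such that `c n m b (ρ m)` holds; then output
`o b`. -/
theorem exists_search {β : Type*} [Primcodable β] {c : ℕ → ℕ → β → ℕ → Bool} {o : β → ℕ}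
    (hc : Computable fun x : ℕ × ℕ × β × ℕ => c x.1 x.2.1 x.2.2.1 x.2.2.2) (ho : Computable o) :
    ∃ Φ : (ℕ → ℕ) → ℕ →. ℕ, RecursiveFunctional Φ ∧ ∀ (ρ : ℕ → ℕ) (n : ℕ),
      (∃ m b, c n m b (ρ m) = true) → ∃ m b, c n m b (ρ m) = true ∧ Φ ρ n = Part.some (o b) := by
  let dec : ℕ → Option β := Encodable.decode
  have hdec : Computable dec := Computable.decode
  have hu : Computable Nat.unpair := Computable.unpair
  -- Here `v` codes `((n, w), ρ m)`, where `w` codes `(m, b)`. The value `0` means success, as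
  -- `rfind` looks for a zero; the default `false` rejects every `w` that does not decode.
  let C : ℕ → ℕ := fun v =>
    bif ((dec v.unpair.1.unpair.2.unpair.2).map fun b =>
      c v.unpair.1.unpair.1 v.unpair.1.unpair.2.unpair.1 b v.unpair.2).getD false then 0 else 1
  have hC : Computable C := by
    have h₁ : Computable fun v : ℕ => dec v.unpair.1.unpair.2.unpair.2 := by fun_prop
    have h₂ : ∀ f g h : ℕ → ℕ, Computable f → Computable g → Computable h →
        Computable fun x : ℕ × β => c (f x.1) (g x.1) x.2 (h x.1) := fun f g h hf hg hh =>
      hc.comp (by fun_prop : Computable fun x : ℕ × β => (f x.1, g x.1, x.2, h x.1))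
    have h₃ := h₂ (fun v => v.unpair.1.unpair.1) (fun v => v.unpair.1.unpair.2.unpair.1)
      (fun v => v.unpair.2) (by fun_prop) (by fun_prop) (by fun_prop)
    exact Computable.cond (Primrec.option_getD.to_comp.comp (Computable.option_map h₁ h₃)
      (Computable.const false)) (Computable.const 0) (Computable.const 1)
  let O : ℕ → ℕ := fun w => ((dec w.unpair.2).map o).getD 0
  have hO : Computable O := by
    have h₁ : Computable fun w : ℕ => dec w.unpair.2 := by fun_prop
    have h₂ : Computable₂ fun (_ : ℕ) (b : β) => o b := ho.comp Computable.snd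
    exact Primrec.option_getD.to_comp.comp (Computable.option_map h₁ h₂) (Computable.const 0)
  have hid : RecursiveFunctional fun _ n => Part.some n := of_computable Computable.id
  have hm : RecursiveFunctional fun _ n => Part.some n.unpair.2.unpair.1 :=
    of_computable (f := fun n => n.unpair.2.unpair.1) (by fun_prop)
  have hΨ : RecursiveFunctional fun ρ n => Part.some (C (Nat.pair n (ρ n.unpair.2.unpair.1))) := by
    simpa using (of_computable hC).comp (hid.pair (oracle.comp hm))
  refine ⟨_, (of_computable hO).comp hΨ.rfind, fun ρ n ⟨m, b, hmb⟩ => ?_⟩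
  simp only [Part.map_some]
  obtain ⟨w, hw, -⟩ := Nat.rfind_min' (p := fun w => decide
      (C (Nat.pair (Nat.pair n w) (ρ (Nat.pair n w).unpair.2.unpair.1)) = 0))
    (m := Nat.pair m (Encodable.encode b)) (by simp [C, dec, hmb])
  have hspec := Nat.rfind_spec hw
  simp only [PFun.coe_val, Part.mem_some_iff, C, Nat.unpair_pair] at hspec
  cases hb : dec w.unpair.2 with
  | none => simp [hb] at hspec
  | some b' =>
    refine ⟨w.unpair.1, b', ?_, (congrArg (fun p => p.bind fun a => Part.some (O a))
      (Part.eq_some_iff.2 hw)).trans (by simp [O, hb])⟩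
    by_contra hne
    rw [Bool.not_eq_true] at hne
    simp [hb, hne] at hspec

end RecursiveFunctional

/-! ### Natural number approximations of distances -/

theorem ratOfCode_eq_sub_div_iff (q : ℕ × ℕ × ℕ) (m i s : ℕ) :
    ratOfCode q = ((m : ℚ) - i) / 2 ^ s ↔
      q.1 * 2 ^ s + i * (q.2.2 + 1) = q.2.1 * 2 ^ s + m * (q.2.2 + 1) := by
  rw [ratOfCode, div_eq_div_iff (by positivity) (by positivity), ← Nat.cast_inj (R := ℚ)]
  push_cast
  constructor <;> intro h <;> linarith

namespace Presentation

section Approximation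

variable {X : Type*} [TopologicalSpace X]

/-- `D (k, l, s)` approximates `2ˢ d(p_k, p_l)` with error less than `1`. -/
def IsApproximation (P : Presentation X) (D : ℕ × ℕ × ℕ → ℕ) : Prop :=
  ∀ k l s, |P.d (P.pts k) (P.pts l) * 2 ^ s - D (k, l, s)| < 1

theorem IsComputable.exists_isApproximation {P : Presentation X} (hP : P.IsComputable) :
    ∃ D, Computable D ∧ P.IsApproximation D := by
  obtain ⟨f, hf, hname⟩ := hP
  -- For `a = (k, l, s)` and `b = (t, m)`: entry `t` of the enumeration is `((m - 1) / 2ˢ, k, l, (m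
  -- + 1) / 2ˢ)`, written without subtraction or division. The floor of `2ˢ d(p_k, p_l)` is such an
  -- `m`.
  let p : ℕ × ℕ × ℕ → ℕ × ℕ → Bool := fun a b =>
    (decide ((f b.1).2.1 = a.1) && decide ((f b.1).2.2.1 = a.2.1)) &&
    (decide ((f b.1).1.1 * 2 ^ a.2.2 + 1 * ((f b.1).1.2.2 + 1) =
      (f b.1).1.2.1 * 2 ^ a.2.2 + b.2 * ((f b.1).1.2.2 + 1)) &&
    decide ((f b.1).2.2.2.1 * 2 ^ a.2.2 + 0 * ((f b.1).2.2.2.2.2 + 1) =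
      (f b.1).2.2.2.2.1 * 2 ^ a.2.2 + (b.2 + 1) * ((f b.1).2.2.2.2.2 + 1)))
  have hp : Computable fun x : (ℕ × ℕ × ℕ) × ℕ × ℕ => p x.1 x.2 := by
    simp only [p]
    fun_prop
  have spec : ∀ a b, p a b = true ↔ (f b.1).2.1 = a.1 ∧ (f b.1).2.2.1 = a.2.1 ∧
      ratOfCode (f b.1).1 = ((b.2 : ℚ) - 1) / 2 ^ a.2.2 ∧
      ratOfCode (f b.1).2.2.2 = ((b.2 : ℚ) + 1) / 2 ^ a.2.2 := by
    intro a b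
    have h₁ := ratOfCode_eq_sub_div_iff (f b.1).1 b.2 1 a.2.2
    have h₂ := ratOfCode_eq_sub_div_iff (f b.1).2.2.2 (b.2 + 1) 0 a.2.2
    push_cast at h₁ h₂
    rw [sub_zero] at h₂
    rw [h₁, h₂]
    simp only [p, Bool.and_eq_true, decide_eq_true_eq, and_assoc]
  obtain ⟨g, hg, hpg⟩ := Computable.exists_of_forall_exists hp fun a => by
    obtain ⟨k, l, s⟩ := a
    have h2 : (0 : ℝ) < 2 ^ s := by positivity
    have hd : 0 ≤ P.d (P.pts k) (P.pts l) * 2 ^ s := mul_nonneg (P.d_nonneg _ _) h2.le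
    set m := ⌊P.d (P.pts k) (P.pts l) * 2 ^ s⌋₊ with hm
    have h₁ := Nat.floor_le hd
    have h₂ := Nat.lt_floor_add_one (P.d (P.pts k) (P.pts l) * 2 ^ s)
    have hmem : (((m : ℚ) - 1) / 2 ^ s, k, l, ((m : ℚ) + 1) / 2 ^ s) ∈ P.diagram := by
      simp only [diagram, Set.mem_ofPred_eq]
      push_cast
      rw [div_lt_iff₀ h2, lt_div_iff₀ h2]
      exact ⟨by linarith, h₂⟩
    rw [hname] at hmem
    obtain ⟨t, ht⟩ := hmem
    simp only [Prod.mk.injEq] at ht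
    exact ⟨(t, m), (spec _ _).2 ⟨ht.2.1, ht.2.2.1, ht.1, ht.2.2.2⟩⟩
  refine ⟨fun a => (g a).2, by fun_prop, fun k l s => ?_⟩
  obtain ⟨hk, hl, hr, hr'⟩ := (spec _ _).1 (hpg (k, l, s))
  have hmem : (ratOfCode (f (g (k, l, s)).1).1, k, l, ratOfCode (f (g (k, l, s)).1).2.2.2) ∈
      P.diagram := by
    rw [hname]
    exact ⟨(g (k, l, s)).1, by simp only [hk, hl]⟩
  rw [hr, hr'] at hmem
  have h2 : (0 : ℝ) < 2 ^ s := by positivity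
  simp only [diagram, Set.mem_ofPred_eq] at hmem
  push_cast at hmem
  rw [div_lt_iff₀ h2, lt_div_iff₀ h2] at hmem
  rw [abs_lt]
  constructor <;> linarith [hmem.1, hmem.2]

/-- At precision `s`, the ball of radius `2⁻ⁱ` around `p_k` is seen to be formally inside the ball
of radius `2⁻ʲ` around `p_l`. -/
def nearCheck (D : ℕ × ℕ × ℕ → ℕ) (i j k l s : ℕ) : Bool :=
  decide ((D (k, l, s) + 1) * 2 ^ (i + j) + 2 ^ (s + j) ≤ 2 ^ (s + i))

/-- At precision `s`, the balls of radius `2⁻ʲ` around `p_k` and `p_l` are seen to be formally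
disjoint. -/
def farCheck (D : ℕ × ℕ × ℕ → ℕ) (j k l s : ℕ) : Bool :=
  decide (2 * 2 ^ s + 2 ^ j ≤ D (k, l, s) * 2 ^ j)

variable {P : Presentation X} {D : ℕ × ℕ × ℕ → ℕ}

theorem nearCheck_iff {i j k l s : ℕ} : nearCheck D i j k l s = true ↔
    ((D (k, l, s) : ℝ) + 1) / 2 ^ s + (1 / 2) ^ i ≤ (1 / 2) ^ j := by
  rw [nearCheck, decide_eq_true_eq, ← Nat.cast_le (α := ℝ)]
  push_cast
  rw [one_div_pow, one_div_pow, div_add_div _ _ (by positivity) (by positivity),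
    div_le_div_iff₀ (by positivity) (by positivity), pow_add, pow_add, pow_add]
  constructor <;> intro h <;> linarith

theorem farCheck_iff {j k l s : ℕ} : farCheck D j k l s = true ↔
    2 * (1 / 2 : ℝ) ^ j ≤ ((D (k, l, s) : ℝ) - 1) / 2 ^ s := by
  rw [farCheck, decide_eq_true_eq, ← Nat.cast_le (α := ℝ)]
  push_cast
  rw [one_div_pow, mul_one_div, div_le_div_iff₀ (by positivity) (by positivity)]
  constructor <;> intro h <;> linarith

theorem IsApproximation.lt_div (hD : P.IsApproximation D) (k l s : ℕ) :
    P.d (P.pts k) (P.pts l) < ((D (k, l, s) : ℝ) + 1) / 2 ^ s := by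
  rw [lt_div_iff₀ (by positivity)]
  linarith [(abs_lt.1 (hD k l s)).2]

theorem IsApproximation.div_lt (hD : P.IsApproximation D) (k l s : ℕ) :
    ((D (k, l, s) : ℝ) - 1) / 2 ^ s < P.d (P.pts k) (P.pts l) := by
  rw [div_lt_iff₀ (by positivity)]
  linarith [(abs_lt.1 (hD k l s)).1]

theorem IsApproximation.of_nearCheck (hD : P.IsApproximation D) {i j k l s : ℕ}
    (h : nearCheck D i j k l s = true) :
    P.d (P.pts k) (P.pts l) + (1 / 2 : ℝ) ^ i < (1 / 2 : ℝ) ^ j := by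
  linarith [hD.lt_div k l s, nearCheck_iff.1 h]

theorem IsApproximation.of_farCheck (hD : P.IsApproximation D) {j k l s : ℕ}
    (h : farCheck D j k l s = true) : 2 * (1 / 2 : ℝ) ^ j < P.d (P.pts k) (P.pts l) := by
  linarith [hD.div_lt k l s, farCheck_iff.1 h]

theorem eventually_two_div_two_pow_lt {ε : ℝ} (hε : 0 < ε) :
    ∀ᶠ s : ℕ in Filter.atTop, (2 : ℝ) / 2 ^ s < ε := by
  have h := (tendsto_pow_atTop_nhds_zero_of_lt_one (by norm_num : (0 : ℝ) ≤ 1 / 2)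
    (by norm_num)).eventually (gt_mem_nhds (half_pos hε))
  filter_upwards [h] with s hs
  rw [one_div_pow] at hs
  rw [← mul_one_div]
  linarith

/-- The check overestimates the distance by less than `2 / 2ˢ`, which eventually drops below the
slack of a strict inequality. Having all large `s` lets finitely many checks share one precision. -/
theorem IsApproximation.eventually_nearCheck (hD : P.IsApproximation D) {i j k l : ℕ}
    (h : P.d (P.pts k) (P.pts l) + (1 / 2 : ℝ) ^ i < (1 / 2 : ℝ) ^ j) :
    ∀ᶠ s in Filter.atTop, nearCheck D i j k l s = true := by
  filter_upwards [eventually_two_div_two_pow_lt (sub_pos.2 h)] with s hs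
  rw [nearCheck_iff]
  have h₁ := hD.div_lt k l s
  have h₂ : ((D (k, l, s) : ℝ) + 1) / 2 ^ s = ((D (k, l, s) : ℝ) - 1) / 2 ^ s + 2 / 2 ^ s := by
    ring
  linarith

theorem IsApproximation.eventually_farCheck (hD : P.IsApproximation D) {j k l : ℕ}
    (h : 2 * (1 / 2 : ℝ) ^ j < P.d (P.pts k) (P.pts l)) :
    ∀ᶠ s in Filter.atTop, farCheck D j k l s = true := by
  filter_upwards [eventually_two_div_two_pow_lt (sub_pos.2 h)] with s hs
  rw [farCheck_iff]
  have h₁ := hD.lt_div k l s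
  have h₂ : ((D (k, l, s) : ℝ) + 1) / 2 ^ s = ((D (k, l, s) : ℝ) - 1) / 2 ^ s + 2 / 2 ^ s := by
    ring
  linarith

variable {α : Type*} [Primcodable α]

@[fun_prop]
theorem computable_nearCheck (hD : Computable D) {i j k l s : α → ℕ} (hi : Computable i)
    (hj : Computable j) (hk : Computable k) (hl : Computable l) (hs : Computable s) :
    Computable fun a => nearCheck D (i a) (j a) (k a) (l a) (s a) := by
  unfold nearCheck
  fun_prop

@[fun_prop]
theorem computable_farCheck (hD : Computable D) {j k l s : α → ℕ}
    (hj : Computable j) (hk : Computable k) (hl : Computable l) (hs : Computable s) :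
    Computable fun a => farCheck D (j a) (k a) (l a) (s a) := by
  unfold farCheck
  fun_prop

end Approximation

/-! ### Computability of the limit map -/

section ComputableMap

variable {X Y : Type*} [TopologicalSpace X] [TopologicalSpace Y]
  {P : Presentation X} {Q : Presentation Y} {j : ℕ → ℕ} {R : ℕ → List (ℕ × ℕ)}

/-- Search for a pair of stage `n` whose first ball is seen to contain the ball of radius `2⁻ᵐ`
around the `m`-th point of the name, and output its second index. Covering makes the search stop and
`IsMatching.d_lt` makes the output correct. -/
theorem IsMatching.isComputableMap (h : IsMatching P Q j R) (hj : Computable j)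
    (hR : Computable R) (hP : P.IsComputable) {f : X → Y}
    (hf : ∀ x, MatchingGraph P Q j R x (f x)) : P.IsComputableMap Q f := by
  obtain ⟨D, hDc, hD⟩ := hP.exists_isApproximation
  let c : ℕ → ℕ → ℕ × ℕ × ℕ → ℕ → Bool := fun n m b r =>
    ((R n).any fun e => decide (e.1 = b.2.1) && decide (e.2 = b.2.2)) &&
      nearCheck D m (j n) r b.2.1 b.1
  have hc : Computable fun x : ℕ × ℕ × (ℕ × ℕ × ℕ) × ℕ => c x.1 x.2.1 x.2.2.1 x.2.2.2 := by
    simp only [c]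
    fun_prop
  have mem_of_c : ∀ {n m s : ℕ} {e : ℕ × ℕ} {r : ℕ}, c n m (s, e) r = true ↔
      e ∈ R n ∧ nearCheck D m (j n) r e.1 s = true := by
    intro n m s e r
    simp only [c, Bool.and_eq_true, List.any_eq_true, decide_eq_true_eq, ← Prod.ext_iff,
      exists_eq_right]
  obtain ⟨Φ, hΦ, hspec⟩ := RecursiveFunctional.exists_search (o := fun b : ℕ × ℕ × ℕ => b.2.2) hc
    (by fun_prop)
  refine ⟨Φ, hΦ, fun x ρ hρ => ?_⟩
  have key : ∀ n, ∃ l, Φ ρ n = Part.some l ∧ Q.d (Q.pts l) (f x) < (1 / 2 : ℝ) ^ n := by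
    intro n
    obtain ⟨m, ⟨s, e⟩, hce, hΦe⟩ := hspec ρ n (by
      obtain ⟨e, he, hx⟩ := (h.covers n).1 x
      -- Half the slack, since `2⁻ᵐ` is paid twice: for the error of the name and for the radius.
      obtain ⟨m, hm⟩ := exists_pow_lt_of_lt_one (half_pos (sub_pos.2 hx))
        (by norm_num : (1 / 2 : ℝ) < 1)
      obtain ⟨s, hs⟩ := (hD.eventually_nearCheck (i := m) (j := j n) (k := ρ m) (l := e.1) (by
        have h₁ := P.d_triangle (P.pts (ρ m)) x (P.pts e.1)
        have h₂ := hρ m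
        rw [P.d_comm x (P.pts e.1)] at h₁
        linarith)).exists
      exact ⟨m, (s, e), mem_of_c.2 ⟨he, hs⟩⟩)
    obtain ⟨he, hs⟩ := mem_of_c.1 hce
    refine ⟨e.2, hΦe, h.d_lt he ?_ (hf x)⟩
    have h₁ := hD.of_nearCheck hs
    have h₂ := P.d_triangle (P.pts e.1) (P.pts (ρ m)) x
    have h₃ := hρ m
    rw [P.d_comm (P.pts e.1) (P.pts (ρ m))] at h₂
    linarith
  choose τ hτ using key
  exact ⟨τ, fun n => (hτ n).1, fun n => (hτ n).2⟩

theorem IsMatching.computablyHomeomorphic [CompactSpace X] [CompactSpace Y]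
    (h : IsMatching P Q j R) (hj : Computable j) (hR : Computable R) (hP : P.IsComputable)
    (hQ : Q.IsComputable) : P.ComputablyHomeomorphic Q := by
  obtain ⟨f, hf⟩ := h.exists_homeomorph
  have hswap : Primrec fun L : List (ℕ × ℕ) => L.map Prod.swap :=
    Primrec.list_map Primrec.id (Primrec.pair (Primrec.snd.comp Primrec.snd)
      (Primrec.fst.comp Primrec.snd))
  exact ⟨f, h.isComputableMap hj hR hP hf,
    h.swap.isComputableMap hj (hswap.to_comp.comp hR) hQ fun y =>
      matchingGraph_swap.2 (by simpa using hf (f.symm y))⟩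

end ComputableMap

/-! ### Computing a matching by search -/

section Construction

/-- Every index in the lists `f j` and `g j` occurs in a pair in `R`. -/
def coversCheck (f g : ℕ → List ℕ) (S : ℕ × List (ℕ × ℕ)) : Bool :=
  ((f S.1).all fun k => S.2.any fun e => decide (e.1 = k)) &&
    (g S.1).all fun l => S.2.any fun e => decide (e.2 = l)

/-- At precision `s`, the stage `S'` is seen to separate at scale `2⁻ⁿ`. -/
def separatesCheck (D E : ℕ × ℕ × ℕ → ℕ) (n : ℕ) (S' : ℕ × List (ℕ × ℕ)) (s : ℕ) : Bool :=
  S'.2.all fun e => S'.2.all fun e' =>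
    (farCheck D S'.1 e.1 e'.1 s && farCheck E S'.1 e.2 e'.2 s) ||
      (nearCheck D S'.1 n e.1 e'.1 s && nearCheck E S'.1 n e.2 e'.2 s)

/-- At precision `s`, the stage `S'` is seen to refine `S`. -/
def refinesCheck (D E : ℕ × ℕ × ℕ → ℕ) (S S' : ℕ × List (ℕ × ℕ)) (s : ℕ) : Bool :=
  S'.2.all fun e' => S.2.any fun e =>
    nearCheck D S'.1 S.1 e'.1 e.1 s && nearCheck E S'.1 S.1 e'.2 e.2 s

variable {X Y : Type*} [TopologicalSpace X] [TopologicalSpace Y]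
  {P : Presentation X} {Q : Presentation Y} {D E : ℕ × ℕ × ℕ → ℕ} {f g : ℕ → List ℕ}

theorem coversCheck_iff {S : ℕ × List (ℕ × ℕ)} : coversCheck f g S = true ↔
    (∀ k ∈ f S.1, ∃ e ∈ S.2, e.1 = k) ∧ ∀ l ∈ g S.1, ∃ e ∈ S.2, e.2 = l := by
  simp [coversCheck]

theorem covers_of_coversCheck (hf : P.IsTotalBoundednessFunction f)
    (hg : Q.IsTotalBoundednessFunction g) {S : ℕ × List (ℕ × ℕ)} (h : coversCheck f g S = true) :
    Covers P Q S.1 S.2 := by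
  rw [coversCheck_iff] at h
  constructor
  · intro x
    obtain ⟨k, hk, hx⟩ := hf S.1 x
    obtain ⟨e, he, rfl⟩ := h.1 k hk
    exact ⟨e, he, hx⟩
  · intro y
    obtain ⟨l, hl, hy⟩ := hg S.1 y
    obtain ⟨e, he, rfl⟩ := h.2 l hl
    exact ⟨e, he, hy⟩

theorem separates_of_separatesCheck (hD : P.IsApproximation D) (hE : Q.IsApproximation E)
    {n s : ℕ} {S' : ℕ × List (ℕ × ℕ)} (h : separatesCheck D E n S' s = true) :
    Separates P Q n S'.1 S'.2 := by
  simp only [separatesCheck, List.all_eq_true, Bool.or_eq_true, Bool.and_eq_true] at h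
  exact fun e he e' he' => (h e he e' he').imp
    (fun h => ⟨hD.of_farCheck h.1, hE.of_farCheck h.2⟩)
    fun h => ⟨hD.of_nearCheck h.1, hE.of_nearCheck h.2⟩

theorem refines_of_refinesCheck (hD : P.IsApproximation D) (hE : Q.IsApproximation E)
    {s : ℕ} {S S' : ℕ × List (ℕ × ℕ)} (h : refinesCheck D E S S' s = true) :
    Refines P Q S.1 S.2 S'.1 S'.2 := by
  simp only [refinesCheck, List.all_eq_true, List.any_eq_true, Bool.and_eq_true] at h
  intro e' he'
  obtain ⟨e, he, h₁, h₂⟩ := h e' he'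
  exact ⟨e, he, hD.of_nearCheck h₁, hE.of_nearCheck h₂⟩

theorem eventually_separatesCheck (hD : P.IsApproximation D) (hE : Q.IsApproximation E)
    {n : ℕ} {S' : ℕ × List (ℕ × ℕ)} (h : Separates P Q n S'.1 S'.2) :
    ∀ᶠ s in Filter.atTop, separatesCheck D E n S' s = true := by
  simp only [separatesCheck, List.all_eq_true, Bool.or_eq_true, Bool.and_eq_true]
  refine (Filter.eventually_all_finite (List.finite_toSet S'.2)).2 fun e he =>
    (Filter.eventually_all_finite (List.finite_toSet S'.2)).2 fun e' he' => ?_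
  rcases h e he e' he' with ⟨h₁, h₂⟩ | ⟨h₁, h₂⟩
  · exact ((hD.eventually_farCheck h₁).and (hE.eventually_farCheck h₂)).mono fun _ => Or.inl
  · exact ((hD.eventually_nearCheck h₁).and (hE.eventually_nearCheck h₂)).mono fun _ => Or.inr

theorem eventually_refinesCheck (hD : P.IsApproximation D) (hE : Q.IsApproximation E)
    {S S' : ℕ × List (ℕ × ℕ)} (h : Refines P Q S.1 S.2 S'.1 S'.2) :
    ∀ᶠ s in Filter.atTop, refinesCheck D E S S' s = true := by
  simp only [refinesCheck, List.all_eq_true, List.any_eq_true, Bool.and_eq_true]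
  refine (Filter.eventually_all_finite (List.finite_toSet S'.2)).2 fun e' he' => ?_
  obtain ⟨e, he, h₁, h₂⟩ := h e' he'
  exact ((hD.eventually_nearCheck h₁).and (hE.eventually_nearCheck h₂)).mono fun _ h => ⟨e, he, h⟩

/-- If every covering stage can be refined to any scale, there is a computable matching. -/
theorem exists_computable_isMatching [Nonempty X] [Nonempty Y]
    (hDc : Computable D) (hD : P.IsApproximation D) (hEc : Computable E) (hE : Q.IsApproximation E)
    (hfc : Computable f) (hf : P.IsTotalBoundednessFunction f)
    (hgc : Computable g) (hg : Q.IsTotalBoundednessFunction g)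
    (H : ∀ j R, Covers P Q j R → ∀ n, ∃ j' R', (∀ k ∈ f j', ∃ e ∈ R', e.1 = k) ∧
      (∀ l ∈ g j', ∃ e ∈ R', e.2 = l) ∧ Separates P Q n j' R' ∧ Refines P Q j R j' R') :
    ∃ j R, Computable j ∧ Computable R ∧ IsMatching P Q j R := by
  -- The first disjunct accepts anything when the given stage fails the covering check, so that the
  -- search is total; it never applies along the sequence `U`.
  let p : ℕ × ℕ × List (ℕ × ℕ) → (ℕ × List (ℕ × ℕ)) × ℕ → Bool := fun a b =>
    (!coversCheck f g a.2) ||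
      (coversCheck f g b.1 && (separatesCheck D E a.1 b.1 b.2 && refinesCheck D E a.2 b.1 b.2))
  have hp : Computable fun x : (ℕ × ℕ × List (ℕ × ℕ)) × (ℕ × List (ℕ × ℕ)) × ℕ => p x.1 x.2 := by
    simp only [p, coversCheck, separatesCheck, refinesCheck]
    fun_prop
  obtain ⟨step, hstepc, hstep⟩ := Computable.exists_of_forall_exists hp fun a => by
    obtain ⟨n, S⟩ := a
    cases hS : coversCheck f g S with
    | false => exact ⟨((0, []), 0), by simp [p, hS]⟩
    | true =>
      obtain ⟨j', R', h₁, h₂, hsep, href⟩ := H S.1 S.2 (covers_of_coversCheck hf hg hS) n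
      obtain ⟨s, hs₁, hs₂⟩ := ((eventually_separatesCheck (S' := (j', R')) hD hE hsep).and
        (eventually_refinesCheck (S' := (j', R')) hD hE href)).exists
      have hcov : coversCheck f g (j', R') = true := coversCheck_iff.2 ⟨h₁, h₂⟩
      exact ⟨((j', R'), s), by simp [p, hcov, hs₁, hs₂]⟩
  let S₀ : ℕ × List (ℕ × ℕ) := (0, (f 0).product (g 0))
  let U : ℕ → ℕ × List (ℕ × ℕ) := fun n =>
    Nat.rec (motive := fun _ => ℕ × List (ℕ × ℕ)) S₀ (fun y S => (step (y, S)).1) n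
  have hstep₂ : Computable₂ fun (_ : ℕ) (x : ℕ × ℕ × List (ℕ × ℕ)) => (step x).1 :=
    Computable.fst.comp (hstepc.comp Computable.snd)
  have hU : Computable U := Computable.nat_rec Computable.id (Computable.const S₀) hstep₂
  have hstepU : ∀ n, coversCheck f g (U n) = true → coversCheck f g (U (n + 1)) = true ∧
      separatesCheck D E n (U (n + 1)) (step (n, U n)).2 = true ∧
      refinesCheck D E (U n) (U (n + 1)) (step (n, U n)).2 = true := by
    intro n hn
    have := hstep (n, U n)
    simp only [p, hn, Bool.not_true, Bool.false_or, Bool.and_eq_true] at this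
    exact this
  have hcov : ∀ n, coversCheck f g (U n) = true := by
    intro n
    induction n with
    | zero =>
      obtain ⟨k₀, hk₀, -⟩ := hf 0 (Classical.arbitrary X)
      obtain ⟨l₀, hl₀, -⟩ := hg 0 (Classical.arbitrary Y)
      exact coversCheck_iff.2
        ⟨fun k hk => ⟨(k, l₀), List.pair_mem_product.2 ⟨hk, hl₀⟩, rfl⟩,
          fun l hl => ⟨(k₀, l), List.pair_mem_product.2 ⟨hk₀, hl⟩, rfl⟩⟩
    | succ n ih => exact (hstepU n ih).1
  -- The start `S₀` is only known to cover, so it is dropped; `U (n + 1)` is the stage built to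
  -- separate at scale `2⁻ⁿ`.
  exact ⟨fun n => (U (n + 1)).1, fun n => (U (n + 1)).2, by fun_prop, by fun_prop,
    { covers := fun n => covers_of_coversCheck hf hg (hcov (n + 1))
      separates := fun n => separates_of_separatesCheck hD hE (hstepU n (hcov n)).2.1
      refines := fun n => refines_of_refinesCheck hD hE (hstepU (n + 1) (hcov (n + 1))).2.2 }⟩

end Construction

end Presentation

theorem proposition6p6 (P Q : Presentation (ℕ → Bool))
    (hP : P.IsComputablyCompact) (hQ : Q.IsComputablyCompact) :
    P.ComputablyHomeomorphic Q := by
  obtain ⟨hPc, f, hfc, hf⟩ := hP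
  obtain ⟨hQc, g, hgc, hg⟩ := hQ
  obtain ⟨D, hDc, hD⟩ := hPc.exists_isApproximation
  obtain ⟨E, hEc, hE⟩ := hQc.exists_isApproximation
  obtain ⟨j, R, hj, hR, h⟩ := Presentation.exists_computable_isMatching hDc hD hEc hE hfc hf hgc hg
    fun j R hR n => Presentation.exists_refinement hf hg hR n
  exact h.computablyHomeomorphic hj hR hPc hQc
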